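/- All logarithms are to base $2$, bits are elements of $\mathbb F_2$, and for $f,g:\{0,1\}^n\to\{0,1\}$ and a class $\mathcal C$ of such functions, $\mathrm{corr}(f,g)=|\mathbb E_{x}(-1)^{f(x)+g(x)}|$ for uniform $x$ and $\mathrm{corr}(f,\mathcal C)=\max_{g\in\mathcal C}\mathrm{corr}(f,g)$. A $d$-junta is a function $\{0,1\}^n\to\{0,1\}$ that depends only on the bits in some set of $d$ coordinates; $\mathrm{JUNTA}_{n,d}^{\oplus t}$ is the class of parities of $t$ $d$-juntas. $\Pi_p^{c}$ is the class of functions $f(Y_1,\dots,Y_p)$ computed by deterministic $p$-party number-on-forehead protocols in which $c$ bits are written (each by a prescribed player, as a function of all blocks other than this player's block and of the bits written before), the last bit being the output. A function $\mathrm{Ext}:\{0,1\}^{N}\to\{0,1\}^{\ell}$ is a $(\kappa,\varepsilon)$ oblivious bit-fixing (OBF) extractor if, whenever all but $\kappa$ input bits are fixed and the remaining $\kappa$ bits are uniform and independent, the output is $\varepsilon$-close to uniform in statistical distance. **Theorem.** Let $c\in\mathbb N$ and $A\ge 1$. There is a constant $a$ such that for all constants $b$ and $\gamma>0$ there is a constant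 $C$ for which the following holds. Let $n\ge 2$ and $d\ge 1$ with $d\cdot 2^{C\sqrt{\log n}}\le n$, put $m=\lceil d\log n\rceil$ and $k=\lfloor n/m\rfloor$, let $p$ be an integer with $\sqrt{\log n}/A\le p\le A\sqrt{\log n}$, and put $k'=\lfloor k/p\rfloor$. Let $\mathrm{Ext}:\{0,1\}^{k'}\to\{0,1\}^{\ell}$ be any $(\kappa,\varepsilon)$ OBF extractor with $$\kappa\le \frac{k'}{2^{a\sqrt{\log n}}},\qquad \varepsilon\le 2^{-k'/2^{b\sqrt{\log n}}},\qquad \ell\ge \frac{k'}{2^{b\sqrt{\log n}}},$$ let $f:(\{0,1\}^{\ell})^p\to\{0,1\}$ be any function with $\mathrm{corr}(f,\Pi_p^p)\le 2^{-\gamma\ell/2^p}$, and let $h=f\circ\mathrm{Ext}^p$ be the function on $k$ bits that applies $\mathrm{Ext}$ to each of $p$ contiguous blocks of $k'$ bits and then applies $f$. Let $h\circ\oplus_m^k$ be the function on $n$ bits that takes the parity of each of $k$ contiguous blocks of $m$ bits and then applies $h$. (Bits left over by the roundings are ignored.) Then $$\mathrm{corr}\bigl(h\circ\oplus_m^k,\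 \mathrm{JUNTA}_{n,d}^{\oplus n^c}\bigr)\le \exp\left(-\frac{n}{d\,2^{C\sqrt{\log n}}}\right).$$ -/

import Mathlib

open scoped BigOperators

noncomputable section

/-! Bits are elements of `ZMod 2`, a string of `n` bits is a function `Fin n → ZMod 2`. -/

/-- The sign `e(b) = (-1)^b` of a bit. -/
def bitSign (b : ZMod 2) : ℝ := (-1 : ℝ) ^ b.val

/-- The correlation `|𝔼_x (-1)^{f(x)+g(x)}|` under the uniform distribution on a finite set. -/
def corr {Ω : Type*} [Fintype Ω] (f g : Ω → ZMod 2) : ℝ :=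
  |Finset.univ.expect fun x : Ω => bitSign (f x + g x)|

/-- The maximal correlation of `f` with a member of the class `𝒞` (a maximum over a finite set). -/
def corrClass {Ω : Type*} [Fintype Ω] (f : Ω → ZMod 2) (𝒞 : Set (Ω → ZMod 2)) : ℝ :=
  sSup (corr f '' 𝒞)

/-- `d`-juntas on `n` bits: functions that are determined by the bits in a set of size `d`. -/
def junta (n d : ℕ) : Set ((Fin n → ZMod 2) → ZMod 2) :=
  {φ | ∃ S : Finset (Fin n), S.card = d ∧
    ∃ φ' : (S → ZMod 2) → ZMod 2, ∀ x, φ x = φ' (fun i => x i)}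

/-- Parities of `t` many `d`-juntas on `n` bits. -/
def juntaXor (n d t : ℕ) : Set ((Fin n → ZMod 2) → ZMod 2) :=
  {g | ∃ φ : Fin t → (Fin n → ZMod 2) → ZMod 2,
    (∀ i, φ i ∈ junta n d) ∧ ∀ x, g x = ∑ i, φ i x}

/-- A deterministic number-on-forehead protocol for `k` players, each with an `ℓ`-bit block on the
forehead, in which `c` bits are written. The `j`-th bit is written by the player `speaker j`, and
it is a function of all blocks other than the block of that player and of the earlier bits. -/
structure NOFProtocol (k ℓ c : ℕ) where
  speaker : Fin c → Fin k
  message : (j : Fin c) → ({i : Fin k // i ≠ speaker j} → Fin ℓ → ZMod 2) →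
    (Fin j → ZMod 2) → ZMod 2

/-- `T X j` is the `j`-th bit that is written on input `X` (this determines `T`). -/
def NOFProtocol.IsTranscript {k ℓ c : ℕ} (Q : NOFProtocol k ℓ c)
    (T : (Fin k → Fin ℓ → ZMod 2) → Fin c → ZMod 2) : Prop :=
  ∀ X j, T X j = Q.message j (fun i => X i) (fun i => T X ⟨i, i.isLt.trans j.isLt⟩)

/-- The functions computed by `k`-party number-on-forehead protocols with `c` bits of
communication; the output is the last (the `c`-th) bit that is written. -/
def nofClass (k ℓ c : ℕ) : Set ((Fin k → Fin ℓ → ZMod 2) → ZMod 2) :=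
  {f | ∃ (Q : NOFProtocol k ℓ c) (T : (Fin k → Fin ℓ → ZMod 2) → Fin c → ZMod 2),
    Q.IsTranscript T ∧ ∃ hc : 0 < c, ∀ X, f X = T X ⟨c - 1, Nat.sub_lt hc Nat.one_pos⟩}

/-- The probability of an event under the uniform distribution on a finite set. -/
def unifProb {Ω : Type*} (E : Set Ω) : ℝ := (Nat.card E : ℝ) / (Nat.card Ω : ℝ)

/-- `(κ, ε)`-extractors for oblivious bit-fixing sources. Such a source keeps the bits in a set
`S` of size `κ` uniform and independent and fixes every other bit `i` to `z i`, that is, it is the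
law of `S.piecewise x z` for uniform `x`; the law of the output has to be `ε`-close to uniform. -/
def IsOBFExtractor {N ℓ : ℕ} (Ext : (Fin N → ZMod 2) → (Fin ℓ → ZMod 2)) (κ : ℕ) (ε : ℝ) : Prop :=
  ∀ (S : Finset (Fin N)) (z : Fin N → ZMod 2), S.card = κ →
    ∀ E : Set (Fin ℓ → ZMod 2),
      |unifProb {x : Fin N → ZMod 2 | Ext (S.piecewise x z) ∈ E} - unifProb E| ≤ ε

/-- The `i`-th of `q` contiguous blocks of `r` bits of a string of `N ≥ q * r` bits. -/
def inputBlock {N q r : ℕ} (h : q * r ≤ N) (x : Fin N → ZMod 2) (i : Fin q) : Fin r → ZMod 2 :=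
  fun j => x ⟨i * r + j, by
    have hi : ((i : ℕ) + 1) * r ≤ q * r := Nat.mul_le_mul_right r i.isLt
    have hj := j.isLt
    rw [Nat.add_mul, Nat.one_mul] at hi
    omega⟩

/-- The composition `f ∘ g^q`, mapping `x` to `f (g x₁, …, g x_q)` for the blocks `x_i` of `x`. -/
def blockComp {N q r : ℕ} {β : Type*} (h : q * r ≤ N) (f : (Fin q → β) → ZMod 2)
    (g : (Fin r → ZMod 2) → β) : (Fin N → ZMod 2) → ZMod 2 :=
  fun x => f fun i => g (inputBlock h x i)

/-- The parity of `m` bits. -/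
def parity (m : ℕ) (x : Fin m → ZMod 2) : ZMod 2 := ∑ j, x j

/-- `f ∘ Ext^p` on `k` bits, with `p` blocks of `⌊k / p⌋` bits. -/
def extComp {k p ℓ : ℕ} (f : (Fin p → Fin ℓ → ZMod 2) → ZMod 2)
    (Ext : (Fin (k / p) → ZMod 2) → (Fin ℓ → ZMod 2)) : (Fin k → ZMod 2) → ZMod 2 :=
  blockComp (Nat.mul_div_le k p) f Ext

/-- `h ∘ ⊕_m^k` on `n` bits, with `k = ⌊n / m⌋` blocks of `m` bits. -/
def parityComp {n m : ℕ} (h : (Fin (n / m) → ZMod 2) → ZMod 2) : (Fin n → ZMod 2) → ZMod 2 :=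
  blockComp (Nat.div_mul_le_self n m) h (parity m)

/-- The block length `m = d log₂ n`, rounded up. -/
def parityLen (n d : ℕ) : ℕ := ⌈(d : ℝ) * Real.logb 2 n⌉₊

/-- The quantity `2 ^ (a √(log₂ n))`. -/
def twoPowSqrtLog (a : ℝ) (n : ℕ) : ℝ := (2 : ℝ) ^ (a * √(Real.logb 2 n))

end

open Finset

/-! A parity can be rerandomized through any single one of its bits. In each of the `p` extractor
blocks form `κ` groups of `G` parities and select one input bit from every group, so that each junta
contains fewer than `p` selected bits (`exists_selection`). Each junta then misses all selected bits
of some extractor block.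

With the other bits fixed, each extractor reads an oblivious bit-fixing source, and the sum of the
juntas becomes a sum of functions each ignoring one block: a `p`-bit number-on-forehead protocol
(`sum_mem_nofClass`). These functions see the source bits `y`, whereas `f` sees only the extractor
outputs. `exists_sections_expect_le` therefore replaces each `y i` by a well-chosen function of the
output `w i` alone, at cost `2 * ε` per block, without changing which block a function ignores.

This bounds the correlation by `corrClass f (nofClass p ℓ p) + 2 * p * ε`
(`corrClass_parityComp_le`); the rest is choosing constants. -/

lemma abs_bitSign (b : ZMod 2) : |bitSign b| = 1 := by
  simp [bitSign, abs_pow]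

lemma abs_expect_le_of_forall {Ω : Type*} [Fintype Ω] [Nonempty Ω] (F : Ω → ℝ) (B : ℝ)
    (h : ∀ x, |F x| ≤ B) : |univ.expect F| ≤ B :=
  (abs_expect_le _ _).trans (expect_le univ_nonempty fun x _ => h x)

lemma corr_le_one {Ω : Type*} [Fintype Ω] [Nonempty Ω] (f g : Ω → ZMod 2) : corr f g ≤ 1 :=
  abs_expect_le_of_forall _ _ fun _ => (abs_bitSign _).le

lemma corr_le_corrClass {Ω : Type*} [Fintype Ω] [Nonempty Ω] (f : Ω → ZMod 2)
    {𝒞 : Set (Ω → ZMod 2)} {g : Ω → ZMod 2} (hg : g ∈ 𝒞) : corr f g ≤ corrClass f 𝒞 :=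
  le_csSup ⟨1, by rintro _ ⟨g, _, rfl⟩; exact corr_le_one f g⟩ ⟨g, hg, rfl⟩

/-- Averaging over a family of translations. -/
lemma abs_expect_le_of_translate {X Y : Type*} [Fintype X] [AddCommGroup X] [Fintype Y]
    [AddCommGroup Y] (F : X → ℝ) (τ : Y → X) (P : X → Y) (B : ℝ)
    (h : ∀ x, |univ.expect fun y => F (x + τ (y - P x))| ≤ B) : |univ.expect F| ≤ B := by
  have h1 : univ.expect F = univ.expect fun x => univ.expect fun y => F (x + τ (y - P x)) := by
    calc univ.expect F = univ.expect fun _ : Y => univ.expect F := by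
          rw [expect_const univ_nonempty]
      _ = univ.expect fun y : Y => univ.expect fun x => F (x + τ y) := by
          refine expect_congr rfl fun y _ => ?_
          exact (Fintype.expect_equiv (Equiv.addRight (τ y)) _ _ fun x => rfl).symm
      _ = univ.expect fun x => univ.expect fun y => F (x + τ y) := expect_comm _ _ _
      _ = _ := by
          refine expect_congr rfl fun x _ => ?_
          exact (Fintype.expect_equiv (Equiv.subRight (P x)) _ _ fun y => rfl).symm
  rw [h1]
  exact abs_expect_le_of_forall _ _ h

/-! ### Random selection by an exponential moment -/

/-- Selecting one element from each of a family of disjoint sets so that every one of `t` sets of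
size `d` contains few selected elements. -/
lemma exists_selection {J T I : Type*} [Fintype J] [DecidableEq J] [Fintype T] [Nonempty T]
    [DecidableEq I] (pos : J → T → I)
    (hpos : Function.Injective fun a : J × T => pos a.1 a.2) {t d p : ℕ} (hd : 0 < d)
    (S : Fin t → Finset I) (hS : ∀ i, (S i).card = d)
    (hcount : t * Real.exp 1 < (1 + (Fintype.card T : ℝ) / d) ^ p) :
    ∃ s : J → T, ∀ i, (univ.filter fun j => pos j (s j) ∈ S i).card < p := by
  classical
  by_contra! hbad
  set D : ℝ := (Fintype.card T : ℝ) with hD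
  have hD0 : 0 < D := by rw [hD]; exact_mod_cast Fintype.card_pos
  have hd0 : (0 : ℝ) < d := by exact_mod_cast hd
  -- For uniform `s`, the mean of `(1 + lam)` to the number of hits in a `d`-set is at most `exp
  -- (lam * d / D)`; this `lam` makes it `e`.
  set lam : ℝ := D / d with hlam
  have hlam0 : 0 < lam := by positivity
  let w : Fin t → J → T → ℝ := fun i j v => if pos j v ∈ S i then 1 + lam else 1
  have hw0 : ∀ i j v, 0 ≤ w i j v := by
    intro i j v; simp only [w]; split_ifs <;> positivity
  have hlow : ∀ s : J → T, (1 + lam) ^ p ≤ ∑ i, ∏ j, w i j (s j) := by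
    intro s
    obtain ⟨i, hi⟩ := hbad s
    calc (1 + lam) ^ p ≤ (1 + lam) ^ (univ.filter fun j => pos j (s j) ∈ S i).card :=
          pow_le_pow_right₀ (by linarith) hi
      _ = ∏ j, w i j (s j) := by simp [w, prod_ite]
      _ ≤ _ := single_le_sum (f := fun i => ∏ j, w i j (s j))
          (fun i _ => prod_nonneg fun j _ => hw0 i j _) (mem_univ i)
  have hup : ∀ i, ∑ s : J → T, ∏ j, w i j (s j) ≤ D ^ Fintype.card J * Real.exp 1 := by
    intro i
    have h1 : ∑ s : J → T, ∏ j, w i j (s j) = ∏ j, ∑ v, w i j v := by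
      rw [prod_univ_sum, Fintype.piFinset_univ]
    have h2 : ∀ j, ∑ v, w i j v
        ≤ D * Real.exp ((univ.filter fun v => pos j v ∈ S i).card / d) := by
      intro j
      have : ∑ v, w i j v = D * ((univ.filter fun v => pos j v ∈ S i).card / d + 1) := by
        have e : ∀ v, w i j v = 1 + if pos j v ∈ S i then lam else 0 := by
          intro v; simp only [w]; split_ifs <;> simp
        simp only [e, sum_add_distrib, ← sum_filter, sum_const, nsmul_eq_mul]
        rw [hlam]; simp only [card_univ, ← hD]; field_simp; ring
      rw [this]
      exact mul_le_mul_of_nonneg_left (Real.add_one_le_exp _) hD0.le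
    -- Injectivity of `pos` makes the choice sets disjoint, so together they meet `S i` in at most
    -- `d` points.
    have h3 : ∑ j, (univ.filter fun v => pos j v ∈ S i).card ≤ d := by
      rw [← hS i, ← card_sigma]
      refine card_le_card_of_injOn (fun a => pos a.1 a.2) ?_ ?_
      · rintro ⟨j, v⟩ h; simpa using h
      · rintro ⟨j, v⟩ _ ⟨j', v'⟩ _ h
        have := @hpos (j, v) (j', v') h
        simp only [Prod.mk.injEq] at this
        obtain ⟨rfl, rfl⟩ := this; rfl
    rw [h1]
    refine (prod_le_prod (fun j _ => sum_nonneg fun v _ => hw0 i j v) fun j _ => h2 j).trans ?_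
    rw [prod_mul_distrib, ← Real.exp_sum, prod_const, card_univ, ← sum_div]
    refine mul_le_mul_of_nonneg_left (Real.exp_le_exp.2 ?_) (by positivity)
    rw [div_le_one hd0]
    exact_mod_cast h3
  have hsum : D ^ Fintype.card J * (1 + lam) ^ p ≤ D ^ Fintype.card J * (t * Real.exp 1) := by
    calc D ^ Fintype.card J * (1 + lam) ^ p = ∑ _s : J → T, (1 + lam) ^ p := by
          simp [hD]
      _ ≤ ∑ s : J → T, ∑ i, ∏ j, w i j (s j) := sum_le_sum fun s _ => hlow s
      _ = ∑ i, ∑ s : J → T, ∏ j, w i j (s j) := sum_comm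
      _ ≤ ∑ _i : Fin t, D ^ Fintype.card J * Real.exp 1 := sum_le_sum fun i _ => hup i
      _ = _ := by simp; ring
  exact absurd (le_of_mul_le_mul_left hsum (by positivity)) (not_le.2 hcount)

/-! ### Number-on-forehead protocols -/

/-- A sum of functions, the `j`-th of which does not depend on the `j`-th block, is computed by the
protocol in which every player adds its function to the last bit. -/
lemma sum_mem_nofClass {p ℓ : ℕ} (hp : 0 < p)
    (g : Fin p → (Fin p → Fin ℓ → ZMod 2) → ZMod 2)
    (hg : ∀ j X Y, (∀ i, i ≠ j → X i = Y i) → g j X = g j Y) :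
    (fun X => ∑ j, g j X) ∈ nofClass p ℓ p := by
  -- Player `j` puts `0` for the unseen block, which `g j` ignores. The transcript consists of the
  -- partial sums.
  refine ⟨⟨id, fun j X b => g j (fun i => if h : i ≠ j then X ⟨i, h⟩ else 0) +
      if h : 0 < (j : ℕ) then b ⟨j - 1, Nat.sub_lt h Nat.one_pos⟩ else 0⟩,
    fun X j => ∑ i ∈ Iic j, g i X, ?_, hp, ?_⟩
  · intro X j
    have h1 : g j (fun i => if i ≠ j then X i else 0) = g j X :=
      hg _ _ _ fun i hi => by simp [hi]
    simp only [dite_eq_ite, h1]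
    split_ifs with h
    · have : Iic j = insert j (Iic (⟨j - 1, by omega⟩ : Fin p)) := by
        ext i; simp only [mem_Iic, mem_insert, Fin.le_def, Fin.ext_iff]; omega
      rw [this, sum_insert (by simp only [mem_Iic, Fin.le_def]; omega)]
    · have : Iic j = {j} := by
        ext i; simp only [mem_Iic, mem_singleton, Fin.le_def, Fin.ext_iff]; omega
      rw [this]; simp
  · intro X
    refine sum_congr ?_ fun _ _ => rfl
    ext i; have := i.isLt; simp only [mem_univ, mem_Iic, Fin.le_def, true_iff]; omega

/-! ### Replacing extractor outputs by uniform strings -/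

/-- A function that is bounded by `1` has almost the same mean under two close laws. -/
lemma expect_comp_le_of_close {Y W : Type*} [Fintype Y] [Nonempty Y] [Fintype W] [Nonempty W]
    (E : Y → W) (ε : ℝ)
    (hE : ∀ A : Set W, |unifProb {y | E y ∈ A} - unifProb A| ≤ ε)
    (ψ : W → ℝ) (hψ : ∀ w, |ψ w| ≤ 1) :
    (univ.expect fun y => ψ (E y)) ≤ univ.expect ψ + 2 * ε := by
  classical
  let δ : W → ℝ := fun w => ((univ.filter fun y => E y = w).card : ℝ) / Fintype.card Y
    - 1 / Fintype.card W
  have hδ : ∀ A : Finset W, |∑ w ∈ A, δ w| ≤ ε := by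
    intro A
    convert hE (A : Set W) using 2
    simp only [δ, sum_sub_distrib, ← sum_div, unifProb, Nat.card_eq_fintype_card]
    congr 2
    · rw [← Nat.cast_sum, ← Nat.card_eq_fintype_card (α := {y | E y ∈ (A : Set W)})]
      congr 1
      have : ({y | E y ∈ (A : Set W)} : Set Y) = ↑(univ.filter fun y => E y ∈ A) := by ext; simp
      rw [this, Nat.card_coe_set_eq, Set.ncard_coe_finset]
      rw [card_eq_sum_card_fiberwise (f := E) (t := A) (by intro y; simp)]
      refine sum_congr rfl fun w hw => ?_
      congr 1; ext y; simp; rintro rfl; exact hw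
    · simp
  have h1 : (univ.expect fun y => ψ (E y)) - univ.expect ψ = ∑ w, ψ w * δ w := by
    simp only [Fintype.expect_eq_sum_div_card, δ, mul_sub, sum_sub_distrib]
    congr 1
    · rw [← sum_fiberwise univ E, sum_div]
      refine sum_congr rfl fun w _ => ?_
      rw [sum_congr rfl (g := fun _ => ψ w) (by intro y hy; simp at hy; rw [hy])]
      simp; ring
    · rw [sum_div]; refine sum_congr rfl fun w _ => by ring
  have h2 : ∑ w, ψ w * δ w ≤ ∑ w, |δ w| := sum_le_sum fun w _ =>
    (le_abs_self _).trans (by rw [abs_mul]; exact mul_le_of_le_one_left (abs_nonneg _) (hψ w))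
  -- The events `0 ≤ δ` and `δ < 0` each contribute at most `ε`, whence the factor 2.
  have h3 : ∑ w, |δ w| = ∑ w ∈ univ.filter (fun w => 0 ≤ δ w), δ w
      - ∑ w ∈ univ.filter (fun w => ¬ 0 ≤ δ w), δ w := by
    rw [← sum_filter_add_sum_filter_not univ (fun w => 0 ≤ δ w), sub_eq_add_neg, ← sum_neg_distrib]
    congr 1
    · exact sum_congr rfl fun w hw => abs_of_nonneg (by simpa using hw)
    · exact sum_congr rfl fun w hw => abs_of_neg (by simpa using hw)
  have := abs_le.1 (hδ (univ.filter (fun w => 0 ≤ δ w)))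
  have := abs_le.1 (hδ (univ.filter (fun w => ¬ 0 ≤ δ w)))
  linarith

/-- Replacing a uniform element of `Y` by a suitable preimage of a uniform element of `W`. -/
lemma exists_section_expect_le {Y W : Type*} [Fintype Y] [Nonempty Y] [Fintype W] [Nonempty W]
    (E : Y → W) (ε : ℝ)
    (hE : ∀ A : Set W, |unifProb {y | E y ∈ A} - unifProb A| ≤ ε)
    (ψ : W × Y → ℝ) (hψ : ∀ a, |ψ a| ≤ 1) :
    ∃ σ : W → Y, (univ.expect fun y => ψ (E y, y)) ≤
      (univ.expect fun w => ψ (w, σ w)) + 2 * ε := by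
  -- The section takes a maximizer of `ψ` on each fibre; on empty fibres any value will do.
  have hσ : ∀ w, ∃ y₀ : Y, ∀ y, E y = w → ψ (w, y) ≤ ψ (w, y₀) := by
    intro w
    by_cases h : ∃ y, E y = w
    · obtain ⟨y₀, _, h₀⟩ := Set.exists_max_image {y | E y = w} (fun y => ψ (w, y))
        (Set.toFinite _) h
      exact ⟨y₀, h₀⟩
    · exact ⟨Classical.arbitrary Y, fun y hy => absurd ⟨y, hy⟩ h⟩
  choose σ hσ using hσ
  refine ⟨σ, le_trans ?_ (expect_comp_le_of_close E ε hE (fun w => ψ (w, σ w)) fun w => hψ _)⟩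
  exact expect_le_expect fun y _ => hσ _ y rfl

/-- Splitting off one coordinate of a uniform tuple. -/
lemma expect_pi_split {ι Ω : Type*} [Fintype ι] [DecidableEq ι] [Fintype Ω] (j : ι)
    (F : (ι → Ω) → ℝ) :
    univ.expect F = univ.expect fun a : Ω => univ.expect fun b : {i // i ≠ j} → Ω =>
      F fun i => if h : i = j then a else b ⟨i, h⟩ := by
  rw [← expect_product' univ univ (fun (a : Ω) (b : {i // i ≠ j} → Ω) =>
      F fun i => if h : i = j then a else b ⟨i, h⟩), univ_product_univ]
  refine Fintype.expect_equiv (Equiv.funSplitAt j Ω) _ _ fun x => ?_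
  congr 1; ext i
  by_cases h : i = j
  · subst h; simp
  · simp [h]

/-- The coordinatewise version of `exists_section_expect_le`. -/
lemma exists_sections_expect_le {ι Y W : Type*} [Fintype ι] [DecidableEq ι] [Fintype Y]
    [Nonempty Y] [Fintype W] [Nonempty W] (E : ι → Y → W) (ε : ℝ)
    (hE : ∀ i, ∀ A : Set W, |unifProb {y | E i y ∈ A} - unifProb A| ≤ ε)
    (Φ : (ι → W × Y) → ℝ) (hΦ : ∀ a, |Φ a| ≤ 1) :
    ∃ σ : ι → W → Y, (univ.expect fun y : ι → Y => Φ fun i => (E i (y i), y i)) ≤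
      (univ.expect fun w : ι → W => Φ fun i => (w i, σ i (w i))) + 2 * Fintype.card ι * ε := by
  -- A hybrid argument: the coordinates in `A` have already been replaced. Each coordinate carries
  -- both a `w` and a `y`, so the probability space stays the same; the unused half averages out.
  have key : ∀ A : Finset ι, ∃ σ : ι → W → Y,
      (univ.expect fun x : ι → W × Y => Φ fun i => (E i (x i).2, (x i).2)) ≤
      (univ.expect fun x : ι → W × Y => Φ fun i => if i ∈ A then ((x i).1, σ i (x i).1)
        else (E i (x i).2, (x i).2)) + 2 * A.card * ε := by
    intro A
    induction A using Finset.induction_on with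
    | empty => exact ⟨fun _ _ => Classical.arbitrary Y, by simp⟩
    | insert j A hj ih =>
      obtain ⟨σ, hσ⟩ := ih
      let rest : ({i // i ≠ j} → W × Y) → W × Y → ι → W × Y := fun b a i =>
        if h : i = j then a else if i ∈ A then ((b ⟨i, h⟩).1, σ i (b ⟨i, h⟩).1)
          else (E i (b ⟨i, h⟩).2, (b ⟨i, h⟩).2)
      -- Averaging over the other coordinates before choosing the section makes it depend on
      -- coordinate `j` alone.
      let ψ : W × Y → ℝ := fun a => univ.expect fun b => Φ (rest b a)
      obtain ⟨s, hs⟩ := exists_section_expect_le (E j) ε (hE j) ψ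
        fun a => abs_expect_le_of_forall _ _ fun b => hΦ _
      refine ⟨Function.update σ j s, hσ.trans ?_⟩
      have e1 : (univ.expect fun x : ι → W × Y => Φ fun i => if i ∈ A then
          ((x i).1, σ i (x i).1) else (E i (x i).2, (x i).2))
          = univ.expect fun y => ψ (E j y, y) := by
        rw [expect_pi_split j, ← univ_product_univ, expect_product, expect_comm]
        rw [← expect_const (univ_nonempty (α := W)) (univ.expect fun y => ψ (E j y, y))]
        rw [expect_comm]
        refine expect_congr rfl fun w _ => expect_congr rfl fun y _ => expect_congr rfl fun b _ => ?_
        congr 1; ext1 i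
        by_cases h : i = j
        · subst h; simp [rest, hj]
        · simp [rest, h]
      have e2 : (univ.expect fun x : ι → W × Y => Φ fun i => if i ∈ insert j A then
          ((x i).1, Function.update σ j s i (x i).1) else (E i (x i).2, (x i).2))
          = univ.expect fun w => ψ (w, s w) := by
        rw [expect_pi_split j, ← univ_product_univ, expect_product]
        refine expect_congr rfl fun w _ => ?_
        rw [← expect_const (univ_nonempty (α := Y)) (ψ (w, s w))]
        refine expect_congr rfl fun y _ => expect_congr rfl fun b _ => ?_
        congr 1; ext1 i
        by_cases h : i = j
        · subst h; simp [rest]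
        · simp [rest, h]
      rw [e1, e2, card_insert_of_notMem hj]
      push_cast
      linarith
  obtain ⟨σ, hσ⟩ := key univ
  refine ⟨σ, ?_⟩
  have e1 : (univ.expect fun x : ι → W × Y => Φ fun i => (E i (x i).2, (x i).2))
      = univ.expect fun y : ι → Y => Φ fun i => (E i (y i), y i) := by
    refine (Fintype.expect_equiv (Equiv.arrowProdEquivProdArrow ι (fun _ => W) (fun _ => Y)) _
      (fun a => Φ fun i => (E i (a.2 i), a.2 i)) fun x => rfl).trans ?_
    rw [← univ_product_univ, expect_product]
    exact expect_const univ_nonempty (univ.expect fun y : ι → Y => Φ fun i => (E i (y i), y i))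
  have e2 : (univ.expect fun x : ι → W × Y => Φ fun i => ((x i).1, σ i (x i).1))
      = univ.expect fun w : ι → W => Φ fun i => (w i, σ i (w i)) := by
    refine (Fintype.expect_equiv (Equiv.arrowProdEquivProdArrow ι (fun _ => W) (fun _ => Y)) _
      (fun a => Φ fun i => (a.1 i, σ i (a.1 i))) fun x => rfl).trans ?_
    rw [← univ_product_univ, expect_product]
    exact expect_congr rfl fun w _ => expect_const univ_nonempty (Φ fun i => (w i, σ i (w i)))
  simpa [e1, e2] using hσ

/-- Correlation of `f` composed with maps of nearly uniform output, with a sum of functions each of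
which misses a block. -/
lemma abs_expect_comp_le {p ℓ : ℕ} (hp : 0 < p) {Y : Type*} [Fintype Y] [Nonempty Y]
    (E : Fin p → Y → Fin ℓ → ZMod 2) (ε : ℝ)
    (hE : ∀ i, ∀ A : Set (Fin ℓ → ZMod 2), |unifProb {y | E i y ∈ A} - unifProb A| ≤ ε)
    (f : (Fin p → Fin ℓ → ZMod 2) → ZMod 2) (g : Fin p → (Fin p → Y) → ZMod 2)
    (hg : ∀ j x y, (∀ i, i ≠ j → x i = y i) → g j x = g j y) :
    |univ.expect fun y : Fin p → Y => bitSign (f (fun i => E i (y i)) + ∑ j, g j y)|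
      ≤ corrClass f (nofClass p ℓ p) + 2 * p * ε := by
  -- The replacement lemma is one-sided, so it is applied for both signs.
  have key : ∀ c : ℝ, |c| = 1 →
      c * (univ.expect fun y : Fin p → Y => bitSign (f (fun i => E i (y i)) + ∑ j, g j y))
        ≤ corrClass f (nofClass p ℓ p) + 2 * p * ε := by
    intro c hc
    obtain ⟨σ, hσ⟩ := exists_sections_expect_le E ε hE
      (fun a => c * bitSign (f (fun i => (a i).1) + ∑ j, g j fun i => (a i).2))
      fun a => by rw [abs_mul, hc, abs_bitSign, one_mul]
    simp only [← mul_expect, Fintype.card_fin] at hσ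
    refine hσ.trans (add_le_add_left (le_trans ?_ (corr_le_corrClass f
      (sum_mem_nofClass hp (fun j w => g j fun i => σ i (w i)) ?_))) _)
    · exact (le_abs_self _).trans (by rw [abs_mul, hc, one_mul]; rfl)
    · exact fun j x y h => hg j _ _ fun i hi => by rw [h i hi]
  rw [abs_le]
  have h1 := key 1 (by simp)
  have h2 := key (-1) (by simp)
  constructor <;> linarith

/-! ### From selected bits to bit-fixing sources -/

/-- Correlation with a sum of juntas, given one selected bit in some of the blocks so that every
junta misses the selected bits of one part. -/
lemma abs_expect_extractor_le {n p ℓ m K κ t : ℕ} (hp : 0 < p)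
    (B : Fin p → Fin K → Fin m → Fin n)
    (hB : Function.Injective fun a : Fin p × Fin K × Fin m => B a.1 a.2.1 a.2.2)
    (β : Fin p → Fin κ → Fin K) (hβ : ∀ i, Function.Injective (β i)) (ω : Fin p → Fin κ → Fin m)
    (f : (Fin p → Fin ℓ → ZMod 2) → ZMod 2) (Ext : (Fin K → ZMod 2) → (Fin ℓ → ZMod 2))
    {ε : ℝ} (hExt : IsOBFExtractor Ext κ ε)
    (φ : Fin t → (Fin n → ZMod 2) → ZMod 2) (S : Fin t → Finset (Fin n))
    (hφ : ∀ r x y, (∀ k ∈ S r, x k = y k) → φ r x = φ r y)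
    (hmiss : ∀ r, ∃ i, ∀ u, B i (β i u) (ω i u) ∉ S r) :
    |univ.expect fun x : Fin n → ZMod 2 =>
      bitSign (f (fun i => Ext fun q => ∑ w, x (B i q w)) + ∑ r, φ r x)|
      ≤ corrClass f (nofClass p ℓ p) + 2 * p * ε := by
  have hB' : ∀ i q w i' q' w', B i q w = B i' q' w' ↔ i = i' ∧ q = q' ∧ w = w' := by
    intro i q w i' q' w'
    constructor
    · intro h
      simpa using @hB (i, q, w) (i', q', w') h
    · rintro ⟨rfl, rfl, rfl⟩; rfl
  let τ : (Fin p → Fin K → ZMod 2) → Fin n → ZMod 2 := fun y k =>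
    ∑ i, ∑ u, if k = B i (β i u) (ω i u) then y i (β i u) else 0
  let P : (Fin n → ZMod 2) → Fin p → Fin K → ZMod 2 := fun x i q => ∑ w, x (B i q w)
  have hτ : ∀ y i q, ∑ w, τ y (B i q w) = if q ∈ univ.image (β i) then y i q else 0 := by
    intro y i q
    have h1 : ∑ w, τ y (B i q w) = ∑ u, if q = β i u then y i (β i u) else 0 := by
      have : ∀ w, τ y (B i q w) = ∑ u, if q = β i u ∧ w = ω i u then y i (β i u) else 0 := by
        intro w
        simp only [τ, hB']
        rw [sum_eq_single i]
        · simp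
        · intro i' _ h; simp [h.symm]
        · simp
      simp only [this]
      rw [sum_comm]
      refine sum_congr rfl fun u _ => ?_
      by_cases h : q = β i u <;> simp [h]
    rw [h1]
    split_ifs with h
    · obtain ⟨u, _, rfl⟩ := mem_image.1 h
      simp [(hβ i).eq_iff]
    · refine sum_eq_zero fun u _ => if_neg ?_
      rintro rfl
      exact h (mem_image_of_mem _ (mem_univ _))
  -- Each junta is assigned to one block whose selected bits it misses.
  choose μ hμ using hmiss
  refine abs_expect_le_of_translate _ τ P _ fun x => ?_
  -- Shifting by `y - P x` rather than `y` cancels the old parities, so the selected parities equal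
  -- `y` exactly and the others stay fixed by `x`.
  have hpar : ∀ y i, (fun q => ∑ w, (x + τ (y - P x)) (B i q w))
      = (univ.image (β i)).piecewise (y i) (P x i) := by
    intro y i
    ext q
    simp only [Pi.add_apply, sum_add_distrib, hτ, Finset.piecewise]
    split_ifs
    · simp [P]
    · simp [P]
  have hsum : ∀ y, ∑ r, φ r (x + τ (y - P x))
      = ∑ j, ∑ r ∈ univ.filter (fun r => μ r = j), φ r (x + τ (y - P x)) := fun y =>
    (sum_fiberwise univ μ _).symm
  simp only [hpar, hsum]
  refine abs_expect_comp_le hp (fun i y => Ext ((univ.image (β i)).piecewise y (P x i))) ε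
    (fun i A => hExt _ _ (by rw [card_image_of_injective _ (hβ i)]; simp) A) f
    (fun j y => ∑ r ∈ univ.filter (fun r => μ r = j), φ r (x + τ (y - P x))) ?_
  intro j y y' h
  refine sum_congr rfl fun r hr => hφ r _ _ fun k hk => ?_
  obtain rfl : μ r = j := by simpa using hr
  simp only [Pi.add_apply, τ, Pi.sub_apply]
  congr 1
  refine sum_congr rfl fun i _ => sum_congr rfl fun u _ => ?_
  by_cases hi : i = μ r
  · subst hi
    have : k ≠ B (μ r) (β (μ r) u) (ω (μ r) u) := fun e => hμ r u (e ▸ hk)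
    simp [this]
  · rw [h i hi]

lemma nat_mul_add_inj {r a b a' b' : ℕ} (hb : b < r) (hb' : b' < r)
    (h : a * r + b = a' * r + b') : a = a' ∧ b = b' := by
  have h1 : a = a' := by
    have := congrArg (· / r) h
    simpa [Nat.add_div_of_dvd_right, Nat.mul_div_cancel _ (show 0 < r by omega),
      Nat.div_eq_of_lt hb, Nat.div_eq_of_lt hb', mul_comm _ r, Nat.mul_add_div (show 0 < r by omega)]
      using this
  subst h1
  exact ⟨rfl, by omega⟩

lemma mul_add_lt_mul {q r i j : ℕ} (hi : i < q) (hj : j < r) : i * r + j < q * r := by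
  have : (i + 1) * r ≤ q * r := Nat.mul_le_mul_right r hi
  rw [Nat.add_mul, Nat.one_mul] at this
  omega

/-- The bound on the correlation in terms of the parameters. -/
lemma corrClass_parityComp_le {n m p ℓ κ d t G : ℕ} {ε : ℝ} (hp : 0 < p) (hm : 0 < m)
    (hd : 0 < d) (hG : 0 < G) (hκ : κ * G ≤ n / m / p)
    (hcount : t * Real.exp 1 < (1 + ((G * m : ℕ) : ℝ) / d) ^ p)
    (f : (Fin p → Fin ℓ → ZMod 2) → ZMod 2)
    (Ext : (Fin (n / m / p) → ZMod 2) → (Fin ℓ → ZMod 2)) (hExt : IsOBFExtractor Ext κ ε)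
    (hε : 0 ≤ ε) :
    corrClass (parityComp (m := m) (extComp f Ext)) (juntaXor n d t)
      ≤ corrClass f (nofClass p ℓ p) + 2 * p * ε := by
  have hK : p * (n / m / p) ≤ n / m := Nat.mul_div_le _ _
  have hN : n / m * m ≤ n := Nat.div_mul_le_self _ _
  let B : Fin p → Fin (n / m / p) → Fin m → Fin n := fun i q w =>
    ⟨(i * (n / m / p) + q) * m + w,
      (mul_add_lt_mul ((mul_add_lt_mul i.isLt q.isLt).trans_le hK) w.isLt).trans_le hN⟩
  have hB : Function.Injective fun a : Fin p × Fin (n / m / p) × Fin m => B a.1 a.2.1 a.2.2 := by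
    rintro ⟨i, q, w⟩ ⟨i', q', w'⟩ h
    simp only [B, Fin.mk.injEq] at h
    obtain ⟨h1, h2⟩ := nat_mul_add_inj w.isLt w'.isLt h
    obtain ⟨h3, h4⟩ := nat_mul_add_inj q.isLt q'.isLt h1
    simp [Fin.ext_iff, h2, h3, h4]
  let blk : Fin κ → Fin G → Fin (n / m / p) := fun u v =>
    ⟨u * G + v, (mul_add_lt_mul u.isLt v.isLt).trans_le hκ⟩
  have hblk : ∀ u v u' v', blk u v = blk u' v' → u = u' ∧ v = v' := by
    intro u v u' v' h
    simp only [blk, Fin.mk.injEq] at h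
    obtain ⟨h1, h2⟩ := nat_mul_add_inj v.isLt v'.isLt h
    exact ⟨Fin.ext h1, Fin.ext h2⟩
  have : Nonempty (Fin G × Fin m) := ⟨(⟨0, hG⟩, ⟨0, hm⟩)⟩
  have h0 : 0 ≤ corrClass f (nofClass p ℓ p) + 2 * p * ε :=
    add_nonneg (Real.sSup_nonneg (by rintro _ ⟨g, _, rfl⟩; exact abs_nonneg _)) (by positivity)
  refine Real.sSup_le ?_ h0
  rintro _ ⟨g, ⟨φ, hφ, hg⟩, rfl⟩
  choose S hS φ' hφ' using hφ
  obtain ⟨s, hs⟩ := exists_selection (J := Fin p × Fin κ) (T := Fin G × Fin m)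
    (fun j v => B j.1 (blk j.2 v.1) v.2) (by
      rintro ⟨⟨i, u⟩, v, w⟩ ⟨⟨i', u'⟩, v', w'⟩ h
      have := @hB (i, blk u v, w) (i', blk u' v', w') h
      simp only [Prod.mk.injEq] at this ⊢
      obtain ⟨h1, h2, h3⟩ := this
      obtain ⟨h4, h5⟩ := hblk _ _ _ _ h2
      exact ⟨⟨h1, h4⟩, h5, h3⟩) hd S hS (by simpa using hcount)
  have := abs_expect_extractor_le hp B hB (fun i u => blk u (s (i, u)).1)
    (fun i u u' h => (hblk _ _ _ _ h).1) (fun i u => (s (i, u)).2) f Ext hExt φ S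
    (fun r x y h => by
      rw [hφ', hφ']; congr 1; ext1 k; exact h k k.2) ?_
  · simp only [corr, hg]
    exact this
  · intro r
    -- A junta hitting every extractor block would contain `p` distinct selected bits.
    by_contra! hcon
    choose u hu using hcon
    refine absurd (hs r) (not_lt.2 ?_)
    calc p = (univ : Finset (Fin p)).card := by simp
      _ ≤ _ := card_le_card_of_injOn (fun i => (i, u i)) (by
          intro i _; simpa using hu i) (by
          intro i _ i' _ h; simpa using congrArg Prod.fst h)

/-! ### Estimates for the parameters -/

lemma le_two_rpow {x : ℝ} (hx : 1 ≤ x) : x ≤ (2 : ℝ) ^ x := by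
  have := one_add_mul_self_le_rpow_one_add (s := 1) (by norm_num) hx
  norm_num at this
  linarith

lemma le_two_rpow_mul {x L : ℝ} (hx : 1 ≤ x) (hL : 1 ≤ L) : x ≤ (2 : ℝ) ^ (x * L) :=
  (le_two_rpow hx).trans (Real.rpow_le_rpow_of_exponent_le one_le_two (by nlinarith))

/-- For `κ > N` there are no sources and `ε` would be unconstrained. -/
lemma IsOBFExtractor.nonneg {N ℓ κ : ℕ} {ε : ℝ} {Ext : (Fin N → ZMod 2) → (Fin ℓ → ZMod 2)}
    (h : IsOBFExtractor Ext κ ε) (hκ : κ ≤ N) : 0 ≤ ε := by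
  obtain ⟨S, _, hS⟩ := exists_subset_card_eq (s := (univ : Finset (Fin N))) (n := κ) (by simpa)
  exact (abs_nonneg _).trans (h S 0 hS ∅)

lemma one_le_sqrt_logb {n : ℕ} (hn : 2 ≤ n) : 1 ≤ √(Real.logb 2 n) := by
  rw [Real.one_le_sqrt, Real.le_logb_iff_rpow_le one_lt_two (by positivity), Real.rpow_one]
  exact_mod_cast hn

lemma two_rpow_sqrt_logb_sq {n : ℕ} (hn : 2 ≤ n) :
    (2 : ℝ) ^ (√(Real.logb 2 n) * √(Real.logb 2 n)) = n := by
  have h := one_le_sqrt_logb hn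
  rw [Real.mul_self_sqrt, Real.rpow_logb two_pos (by norm_num) (by positivity)]
  exact (Real.sqrt_pos.1 (by linarith)).le

/-- The union bound over the juntas. -/
lemma junta_count_lt {n d p c : ℕ} {A : ℝ} (hA : 1 ≤ A) (hn : 2 ≤ n) (hd : 1 ≤ d)
    (hp : √(Real.logb 2 n) / A ≤ p) :
    ((n ^ c : ℕ) : ℝ) * Real.exp 1 <
      (1 + ((⌈(2 : ℝ) ^ (A * (c + 2) * √(Real.logb 2 n))⌉₊ * parityLen n d : ℕ) : ℝ) / d) ^ p := by
  have hL := one_le_sqrt_logb hn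
  have hnL := two_rpow_sqrt_logb_sq hn
  have hlog : Real.logb 2 n = √(Real.logb 2 n) * √(Real.logb 2 n) :=
    (Real.mul_self_sqrt (Real.sqrt_pos.1 (by linarith)).le).symm
  have hdm : (d : ℝ) ≤ parityLen n d := by
    refine le_trans ?_ (Nat.le_ceil _)
    rw [hlog]
    exact le_mul_of_one_le_right (by positivity) (by nlinarith)
  set L := √(Real.logb 2 n)
  have hd0 : (0 : ℝ) < d := by exact_mod_cast hd
  have hn2 : (2 : ℝ) ≤ n := by exact_mod_cast hn
  have hLA : L ≤ A * p := by rwa [div_le_iff₀' (by linarith)] at hp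
  have h1 : (2 : ℝ) ^ (A * (c + 2) * L) ≤
      1 + ((⌈(2 : ℝ) ^ (A * (c + 2) * L)⌉₊ * parityLen n d : ℕ) : ℝ) / d := by
    have h2 : (⌈(2 : ℝ) ^ (A * (c + 2) * L)⌉₊ : ℝ) ≤
        ((⌈(2 : ℝ) ^ (A * (c + 2) * L)⌉₊ * parityLen n d : ℕ) : ℝ) / d := by
      rw [le_div_iff₀ hd0]; push_cast
      exact mul_le_mul_of_nonneg_left hdm (by positivity)
    linarith [Nat.le_ceil ((2 : ℝ) ^ (A * (c + 2) * L))]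
  refine lt_of_lt_of_le ?_ (pow_le_pow_left₀ (by positivity) h1 p)
  -- This uses `L ≤ A * p`. The two spare factors `n` beat `e`, since `n ^ 2 ≥ 4`.
  have h3 : ((n : ℝ)) ^ (c + 2) ≤ ((2 : ℝ) ^ (A * (c + 2) * L)) ^ p := by
    conv_lhs => rw [← hnL]
    rw [← Real.rpow_natCast, ← Real.rpow_natCast, ← Real.rpow_mul two_pos.le,
      ← Real.rpow_mul two_pos.le]
    refine Real.rpow_le_rpow_of_exponent_le one_le_two ?_
    push_cast
    have : L * L * (c + 2) ≤ L * (A * p) * (c + 2) := by gcongr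
    linarith
  refine lt_of_lt_of_le ?_ h3
  push_cast
  rw [pow_add]
  refine mul_lt_mul_of_pos_left ?_ (by positivity)
  have := Real.exp_one_lt_d9
  nlinarith

/-- With `L = √(logb 2 n)`, the block length is at most `2 * d * L ^ 2` and `p ≤ A * L`, and the
floor costs another factor 2. The total `4 * A * L ^ 3` is absorbed by `2 ^ ((A + 5) * L)`. -/
lemma block_count_ge {n d p : ℕ} {A C : ℝ} (hA : 1 ≤ A) (hn : 2 ≤ n) (hd : 1 ≤ d) (hp0 : 0 < p)
    (hC : A + 5 ≤ C) (hdn : (d : ℝ) * twoPowSqrtLog C n ≤ n) (hp : p ≤ A * √(Real.logb 2 n)) :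
    (n : ℝ) / (d * twoPowSqrtLog (A + 5) n) ≤ (n / parityLen n d / p : ℕ) := by
  have hL := one_le_sqrt_logb hn
  have hlog : Real.logb 2 n = √(Real.logb 2 n) * √(Real.logb 2 n) :=
    (Real.mul_self_sqrt (Real.sqrt_pos.1 (by linarith)).le).symm
  have hm : (parityLen n d : ℝ) < d * (√(Real.logb 2 n) * √(Real.logb 2 n)) + 1 := by
    unfold parityLen
    rw [← hlog]
    exact Nat.ceil_lt_add_one (by rw [hlog]; positivity)
  unfold twoPowSqrtLog at *
  set L := √(Real.logb 2 n)
  have hd1 : (1 : ℝ) ≤ d := by exact_mod_cast hd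
  have hn0 : (0 : ℝ) < n := by positivity
  have hm0 : 0 < parityLen n d := Nat.ceil_pos.2 (by
    rw [hlog]; positivity)
  set m := parityLen n d
  have hm2 : (m : ℝ) ≤ 2 * d * (L * L) := by nlinarith
  have hmp : 2 * ((m : ℝ) * p) ≤ d * 2 ^ ((A + 5) * L) := by
    have e : (2 : ℝ) ^ ((A + 5) * L) = 2 ^ (A * L) * (2 ^ L) ^ 3 * (2 ^ L) ^ 2 := by
      rw [← Real.rpow_natCast, ← Real.rpow_natCast, ← Real.rpow_mul two_pos.le,
        ← Real.rpow_mul two_pos.le, ← Real.rpow_add two_pos, ← Real.rpow_add two_pos]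
      congr 1; push_cast; ring
    have h1 : A ≤ 2 ^ (A * L) := le_two_rpow_mul hA hL
    have h2 : L ≤ 2 ^ L := le_two_rpow hL
    have h3 : (2 : ℝ) ≤ 2 ^ L := by
      simpa using Real.rpow_le_rpow_of_exponent_le (one_le_two (α := ℝ)) hL
    calc 2 * ((m : ℝ) * p) ≤ 2 * ((2 * d * (L * L)) * (A * L)) := by gcongr
      _ = d * (A * L ^ 3 * 2 ^ 2) := by ring
      _ ≤ d * (2 ^ (A * L) * (2 ^ L) ^ 3 * (2 ^ L) ^ 2) := by gcongr
      _ = _ := by rw [e]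
  have hn2 : 2 * ((m : ℝ) * p) ≤ n := by
    refine hmp.trans (le_trans ?_ hdn)
    gcongr
    norm_num
  have hmp0 : (0 : ℝ) < m * p := by positivity
  calc (n : ℝ) / (d * 2 ^ ((A + 5) * L)) ≤ n / (2 * (m * p)) := by gcongr
    _ ≤ (n / m / p : ℕ) := by
      rw [div_le_iff₀ (by positivity), Nat.div_div_eq_div_mul]
      have h1 : (n : ℝ) < (m * p) * ((n / (m * p) : ℕ) + 1) := by
        exact_mod_cast Nat.lt_mul_div_succ n (Nat.mul_pos hm0 hp0)
      nlinarith

lemma two_rpow_neg_le_exp {x y : ℝ} (hx : 2 * x ≤ y) (hy : 0 ≤ y) :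
    (2 : ℝ) ^ (-y) ≤ Real.exp (-x) := by
  rw [Real.rpow_def_of_pos two_pos, Real.exp_le_exp]
  have := Real.log_two_gt_d9
  nlinarith

theorem mainTheorem4 (c : ℕ) (A : ℝ) (hA : 1 ≤ A) :
    ∃ a : ℝ, ∀ b γ : ℝ, 0 < γ → ∃ C : ℝ,
      ∀ (n d p ℓ κ : ℕ) (ε : ℝ), 2 ≤ n → 1 ≤ d →
        (d : ℝ) * twoPowSqrtLog C n ≤ n →
        √(Real.logb 2 n) / A ≤ p → (p : ℝ) ≤ A * √(Real.logb 2 n) →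
        ∀ (f : (Fin p → Fin ℓ → ZMod 2) → ZMod 2)
          (Ext : (Fin (n / parityLen n d / p) → ZMod 2) → (Fin ℓ → ZMod 2)),
          corrClass f (nofClass p ℓ p) ≤ (2 : ℝ) ^ (-(γ * ℓ / 2 ^ p)) →
          ((n / parityLen n d / p : ℕ) : ℝ) / twoPowSqrtLog b n ≤ ℓ →
          IsOBFExtractor Ext κ ε →
          (κ : ℝ) ≤ ((n / parityLen n d / p : ℕ) : ℝ) / twoPowSqrtLog a n →
          ε ≤ (2 : ℝ) ^ (-(((n / parityLen n d / p : ℕ) : ℝ) / twoPowSqrtLog b n)) →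
          corrClass (parityComp (extComp f Ext)) (juntaXor n d (n ^ c)) ≤
            Real.exp (-((n : ℝ) / (d * twoPowSqrtLog C n))) := by
  -- The first constant gives `G ≤ 2 ^ (a * L)`, so that `κ` groups fit into a block. In `C`, `A +
  -- 5` pays for `block_count_ge`, `b` for the loss in `ℓ` and `ε`, `A` for `2 ^ p`, and `4 / γ` for
  -- `γ`; `|b|` covers negative `b`.
  refine ⟨A * (c + 2) + 1, fun b γ hγ => ⟨(A + 5) + b + A + (4 / γ + |b| + 4) + |b|, ?_⟩⟩
  intro n d p ℓ κ ε hn hd hdn hp1 hp2 f Ext hf hℓ hExt hκ hε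
  set C := (A + 5) + b + A + (4 / γ + |b| + 4) + |b| with hC
  have hb := neg_abs_le b
  have hb' := abs_nonneg b
  have hγ4 : 0 < 4 / γ := by positivity
  have hL := one_le_sqrt_logb hn
  have hlog : Real.logb 2 n = √(Real.logb 2 n) * √(Real.logb 2 n) :=
    (Real.mul_self_sqrt (Real.sqrt_pos.1 (by linarith)).le).symm
  have hd1 : (1 : ℝ) ≤ d := by exact_mod_cast hd
  have hm0 : 0 < parityLen n d := Nat.ceil_pos.2 (by rw [hlog]; positivity)
  have hp0 : 0 < p := by
    have : (0 : ℝ) < p := lt_of_lt_of_le (by positivity) hp1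
    exact_mod_cast this
  have hK := block_count_ge hA hn hd hp0 (C := C) (by linarith) hdn hp2
  have hcount := junta_count_lt (c := c) hA hn hd hp1
  unfold twoPowSqrtLog at *
  set L := √(Real.logb 2 n)
  have hG1 : (1 : ℝ) ≤ 2 ^ (A * (c + 2) * L) := Real.one_le_rpow one_le_two (by positivity)
  set G := ⌈(2 : ℝ) ^ (A * (c + 2) * L)⌉₊ with hG
  have hG0 : 0 < G := Nat.ceil_pos.2 (by linarith)
  have hκG : κ * G ≤ n / parityLen n d / p := by
    have h1 : (G : ℝ) ≤ 2 ^ ((A * (c + 2) + 1) * L) := by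
      have h2 : (G : ℝ) < 2 ^ (A * (c + 2) * L) + 1 := Nat.ceil_lt_add_one (by linarith)
      have h3 : (2 : ℝ) ≤ 2 ^ L := by
        simpa using Real.rpow_le_rpow_of_exponent_le (one_le_two (α := ℝ)) hL
      rw [add_mul, one_mul, Real.rpow_add two_pos]
      nlinarith
    rw [le_div_iff₀ (by positivity)] at hκ
    exact_mod_cast (mul_le_mul_of_nonneg_left h1 (Nat.cast_nonneg κ)).trans hκ
  have hε0 : 0 ≤ ε := hExt.nonneg ((Nat.le_mul_of_pos_right κ hG0).trans hκG)
  refine (corrClass_parityComp_le hp0 hm0 hd hG0 hκG hcount f Ext hExt hε0).trans ?_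
  set K := n / parityLen n d / p
  set X := (n : ℝ) / (d * 2 ^ (C * L)) with hX
  have hX1 : 1 ≤ X := by rwa [hX, one_le_div (by positivity)]
  have hKX : 2 ^ ((C - (A + 5)) * L) * X ≤ K := by
    refine le_trans (le_of_eq ?_) hK
    rw [hX, sub_mul, Real.rpow_sub two_pos]
    field_simp
  have hKb : 2 ^ ((C - (A + 5) - b) * L) * X ≤ K / 2 ^ (b * L) := by
    rw [le_div_iff₀ (by positivity)]
    refine le_trans (le_of_eq ?_) hKX
    rw [sub_mul _ b, Real.rpow_sub two_pos]
    field_simp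
  have hAL : A * L ≤ 2 ^ (A * L) * 2 ^ L :=
    mul_le_mul (le_two_rpow_mul hA hL) (le_two_rpow hL) (by positivity) (by positivity)
  have hpX : 8 * p * X ≤ K / 2 ^ (b * L) := by
    refine le_trans (mul_le_mul_of_nonneg_right ?_ (by linarith)) hKb
    have h3 : (8 : ℝ) ≤ 2 ^ (3 * L) :=
      le_trans (by norm_num) (Real.rpow_le_rpow_of_exponent_le (one_le_two (α := ℝ))
        (show (3 : ℝ) ≤ 3 * L by linarith))
    calc 8 * (p : ℝ) ≤ 2 ^ (3 * L) * (2 ^ (A * L) * 2 ^ L) := by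
          gcongr; exact hp2.trans hAL
      _ = 2 ^ ((3 + A + 1) * L) := by
          rw [← Real.rpow_add two_pos, ← Real.rpow_add two_pos]; congr 1; ring
      _ ≤ _ := Real.rpow_le_rpow_of_exponent_le one_le_two
          (mul_le_mul_of_nonneg_right (by rw [hC]; linarith) (by linarith))
  have hp1' : (1 : ℝ) ≤ p := by exact_mod_cast hp0
  have hfX : 4 * X ≤ γ * ℓ / 2 ^ p := by
    have h2p : (2 : ℝ) ^ p ≤ 2 ^ (A * L) := by
      rw [← Real.rpow_natCast]
      exact Real.rpow_le_rpow_of_exponent_le one_le_two hp2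
    have h4 : 4 / γ ≤ 2 ^ ((4 / γ + 1) * L) :=
      (le_add_of_nonneg_right zero_le_one).trans (le_two_rpow_mul (by linarith) hL)
    have h5 : 4 * 2 ^ (A * L) ≤ γ * 2 ^ ((C - (A + 5) - b) * L) := by
      have h6 : (2 : ℝ) ^ (A * L) * 2 ^ ((4 / γ + 1) * L) ≤ 2 ^ ((C - (A + 5) - b) * L) := by
        rw [← Real.rpow_add two_pos, ← add_mul]
        exact Real.rpow_le_rpow_of_exponent_le one_le_two
          (mul_le_mul_of_nonneg_right (by rw [hC]; linarith) (by linarith))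
      calc 4 * 2 ^ (A * L) = γ * (2 ^ (A * L) * (4 / γ)) := by field_simp
        _ ≤ γ * (2 ^ (A * L) * 2 ^ ((4 / γ + 1) * L)) := by gcongr
        _ ≤ _ := by gcongr
    rw [le_div_iff₀ (by positivity)]
    calc 4 * X * 2 ^ p ≤ 4 * X * 2 ^ (A * L) := by gcongr
      _ = (4 * 2 ^ (A * L)) * X := by ring
      _ ≤ γ * 2 ^ ((C - (A + 5) - b) * L) * X := by gcongr
      _ = γ * (2 ^ ((C - (A + 5) - b) * L) * X) := by ring
      _ ≤ γ * ℓ := by gcongr; exact hKb.trans hℓ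
  -- Both error terms are at most `exp (-2X)`; their sum is at most `exp (-X)` because `X ≥ 1` gives
  -- `exp X ≥ 2`.
  have hA1 : corrClass f (nofClass p ℓ p) ≤ Real.exp (-(2 * X)) :=
    hf.trans (two_rpow_neg_le_exp (by linarith) (by positivity))
  have hA2 : 2 * p * ε ≤ Real.exp (-(2 * X)) := by
    have h1 : ε ≤ Real.exp (-(2 * X) + -(2 * p)) := by
      refine hε.trans ?_
      rw [← neg_add]
      refine two_rpow_neg_le_exp (le_trans ?_ hpX) (by positivity)
      nlinarith
    have h2 : 2 * (p : ℝ) ≤ Real.exp (2 * p) := by linarith [Real.add_one_le_exp (2 * (p : ℝ))]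
    calc 2 * p * ε ≤ Real.exp (2 * p) * Real.exp (-(2 * X) + -(2 * p)) := by gcongr
      _ = _ := by rw [← Real.exp_add]; congr 1; ring
  have hA3 : 2 * Real.exp (-(2 * X)) ≤ Real.exp (-X) := by
    calc 2 * Real.exp (-(2 * X)) ≤ Real.exp X * Real.exp (-(2 * X)) := by
          gcongr; linarith [Real.add_one_le_exp X]
      _ = _ := by rw [← Real.exp_add]; congr 1; ring
  linarith
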